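/- Let $M$ be a finitary matroid (a possibly infinite matroid in which every set whose finite subsets are all independent is itself independent), let $B_0$ and $B_1$ be bases of $M$, let $\kappa$ be a cardinal, and let $B_0=\bigcup_{i<\kappa}X_i$ be a partition of $B_0$ into pairwise disjoint finite sets $X_i$ (empty $X_i$ are allowed). Then there are a partition $B_1=\bigcup_{i<\kappa}Y_i$ into pairwise disjoint sets, with $Y_i\neq\emptyset$ whenever $X_i\neq\emptyset$, and a bijection $\sigma:\kappa\to\kappa$ such that for every $i<\kappa$ both $$(B_0\setminus X_i)\cup Y_i\qquad\text{and}\qquad \Bigl(B_0\setminus\bigcup_{i\le j<\kappa}X_{\sigma(j)}\Bigr)\cup\bigcup_{i\le j<\kappa}Y_{\sigma(j)}$$ are bases of $M$. If $\kappa\le\omega$, then $\sigma$ can be chosen to be the identity. -/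

import Mathlib

universe u v

open Set Cardinal

/-! The blocks are exchanged one after another. If the current base consists of all earlier `X k`
and what is left of `B₁`, symmetric exchange of `X i` between `B₀` and this base gives a set `Y i`.
Since `(B₀ \ X i) ∪ Y i` is a disjoint union, `Y i` avoids the earlier `X k` and so lies in the
remainder of `B₁`. Finite symmetric exchange follows from a splitting theorem for submodular rank
functions.

At a limit, finitarity preserves independence, but spanning can fail. It survives if the blocks used
so far span the same flat as some `C ⊆ B₁`: then only elements of `C` have been removed, and the
blocks span those. For `κ ≤ ω` there are no limits except `0`. For larger `κ`, each block depends on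
countably many others through finite spanning sets, and `κ` is reordered so that initial segments of
limit length are closed under this dependence. -/

namespace Matroid

/-! ### Splitting a finite independent set -/

/-- A partition theorem for a monotone submodular function `r` of unit increase: under a rank
condition, a finite set splits into two parts extending `S` and `T` with full rank increase. -/
lemma exists_subset_add_card_le_of_submodular {α : Type*} [DecidableEq α] {r : Finset α → ℕ}
    (hmono : Monotone r) (hsub : ∀ A B, r (A ∩ B) + r (A ∪ B) ≤ r A + r B)
    (hone : ∀ e A, r (insert e A) ≤ r A + 1) (I S T : Finset α)
    (h : ∀ A ⊆ I, A.card + r S + r T ≤ r (A ∪ S) + r (A ∪ T)) :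
    ∃ Y ⊆ I, r S + Y.card ≤ r (S ∪ Y) ∧ r T + (I \ Y).card ≤ r (T ∪ (I \ Y)) := by
  induction I using Finset.induction_on generalizing S T with
  | empty => exact ⟨∅, by simp⟩
  | insert e I he ih =>
    by_cases hS : ∀ A ⊆ I, A.card + (r S + 1) + r T ≤ r (A ∪ insert e S) + r (A ∪ T)
    · have h0 := hS ∅ (by simp)
      have h1 := hone e S
      simp only [Finset.card_empty, Finset.empty_union] at h0
      obtain ⟨Y, hYI, hY, hY'⟩ := ih (insert e S) T fun A hA ↦ by have := hS A hA; omega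
      have heY : e ∉ Y := fun h ↦ he (hYI h)
      refine ⟨insert e Y, Finset.insert_subset_insert e hYI, ?_, ?_⟩
      · rw [Finset.card_insert_of_notMem heY, Finset.union_insert, ← Finset.insert_union]
        omega
      · rwa [Finset.insert_sdiff_insert, Finset.sdiff_insert_of_notMem he]
    by_cases hT : ∀ A ⊆ I, A.card + r S + (r T + 1) ≤ r (A ∪ S) + r (A ∪ insert e T)
    · have h0 := hT ∅ (by simp)
      have h1 := hone e T
      simp only [Finset.card_empty, Finset.empty_union] at h0
      obtain ⟨Y, hYI, hY, hY'⟩ := ih S (insert e T) fun A hA ↦ by have := hT A hA; omega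
      have heY : e ∉ Y := fun h ↦ he (hYI h)
      refine ⟨Y, hYI.trans (Finset.subset_insert e I), hY, ?_⟩
      rw [Finset.insert_sdiff_of_notMem _ heY, Finset.card_insert_of_notMem (by simp [he]),
        Finset.union_insert, ← Finset.insert_union]
      omega
    -- If `e` fits on neither side, uncrossing the violating sets `A` and `A'` contradicts `h` for
    -- `insert e (A ∪ A')` and `A ∩ A'`: the extra `e` costs one more than submodularity leaves.
    push Not at hS hT
    obtain ⟨A, hA, hAS⟩ := hS
    obtain ⟨A', hA', hAT⟩ := hT
    have hU := h (insert e (A ∪ A'))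
      (Finset.insert_subset_insert e (Finset.union_subset hA hA'))
    have hV := h (A ∩ A') ((Finset.inter_subset_left.trans hA).trans (Finset.subset_insert e I))
    have hsubS := hsub (A ∪ insert e S) (A' ∪ S)
    have hsubT := hsub (A ∪ T) (A' ∪ insert e T)
    have hS1 : r (A ∩ A' ∪ S) ≤ r ((A ∪ insert e S) ∩ (A' ∪ S)) := hmono (by
      intro x; simp only [Finset.mem_union, Finset.mem_inter, Finset.mem_insert]; tauto)
    have hT1 : r (A ∩ A' ∪ T) ≤ r ((A ∪ T) ∩ (A' ∪ insert e T)) := hmono (by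
      intro x; simp only [Finset.mem_union, Finset.mem_inter, Finset.mem_insert]; tauto)
    have hS2 : r (insert e (A ∪ A') ∪ S) ≤ r ((A ∪ insert e S) ∪ (A' ∪ S)) := hmono (by
      intro x; simp only [Finset.mem_union, Finset.mem_insert]; tauto)
    have hT2 : r (insert e (A ∪ A') ∪ T) ≤ r ((A ∪ T) ∪ (A' ∪ insert e T)) := hmono (by
      intro x; simp only [Finset.mem_union, Finset.mem_insert]; tauto)
    have hcard := Finset.card_union_add_card_inter A A'
    rw [Finset.card_insert_of_notMem
      (by simpa using ⟨fun h ↦ he (hA h), fun h ↦ he (hA' h)⟩)] at hU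
    omega

variable {α : Type*} {M : Matroid α}

lemma indep_union_of_toNat_eRk [DecidableEq α] {S Y : Finset α} (hS : M.Indep (S : Set α))
    (h : (M.eRk (S : Set α)).toNat + Y.card ≤ (M.eRk ((S ∪ Y : Finset α) : Set α)).toNat) :
    M.Indep (S ∪ Y : Set α) ∧ Disjoint S Y := by
  rw [hS.eRk_eq_encard, encard_coe_eq_coe_finsetCard, ENat.toNat_natCast] at h
  have hle : M.eRk ((S ∪ Y : Finset α) : Set α) ≤ ((S ∪ Y).card : ℕ∞) := by
    rw [← encard_coe_eq_coe_finsetCard]; exact M.eRk_le_encard _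
  have hne : M.eRk ((S ∪ Y : Finset α) : Set α) ≠ ⊤ := ne_top_of_le_ne_top (by simp) hle
  have hle' := ENat.toNat_le_toNat hle (by simp)
  rw [ENat.toNat_natCast] at hle'
  have hcard := Finset.card_union_add_card_inter S Y
  refine ⟨?_, ?_⟩
  · rw [← Finset.coe_union, indep_iff_eRk_eq_encard_of_finite (Finset.finite_toSet _),
      encard_coe_eq_coe_finsetCard, ← ENat.natCast_toNat hne]
    congr 1
    omega
  · rw [Finset.disjoint_iff_inter_eq_empty, ← Finset.card_eq_zero]
    omega

/-- If `S` and `T` are disjoint finite sets with independent union, then every finite independent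
set `I` splits into two parts that extend `S` and `T` to independent sets. -/
lemma exists_subset_indep_union_indep_union_sdiff [DecidableEq α] {S T I : Finset α}
    (hST : M.Indep (S ∪ T : Set α)) (hdj : Disjoint S T) (hI : M.Indep (I : Set α)) :
    ∃ Y ⊆ I, M.Indep (S ∪ Y : Set α) ∧ Disjoint S Y ∧
      M.Indep (T ∪ (I \ Y : Finset α) : Set α) ∧ Disjoint T (I \ Y) := by
  have hfin (A : Finset α) : M.eRk (A : Set α) ≠ ⊤ :=
    ne_top_of_le_ne_top (by simp) (M.eRk_le_encard A)
  have hS := hST.subset subset_union_left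
  have hT := hST.subset subset_union_right
  have hmono : Monotone fun A : Finset α ↦ (M.eRk (A : Set α)).toNat := fun A B hAB ↦
    ENat.toNat_le_toNat (M.eRk_mono (by simpa using hAB)) (hfin B)
  have hsub (A B : Finset α) : (M.eRk ((A ∩ B : Finset α) : Set α)).toNat +
      (M.eRk ((A ∪ B : Finset α) : Set α)).toNat ≤
      (M.eRk (A : Set α)).toNat + (M.eRk (B : Set α)).toNat := by
    rw [← ENat.toNat_add (hfin _) (hfin _), ← ENat.toNat_add (hfin _) (hfin _)]
    refine ENat.toNat_le_toNat ?_ (by simp [hfin])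
    simpa using M.eRk_inter_add_eRk_union_le A B
  obtain ⟨Y, hYI, hY, hY'⟩ := exists_subset_add_card_le_of_submodular hmono hsub
    (fun e A ↦ by
      have := ENat.toNat_le_toNat (M.eRk_insert_le_add_one e A) (by simp [hfin])
      rw [ENat.toNat_add (hfin _) (by simp)] at this
      simpa using this) I S T (fun A hA ↦ by
      -- Submodularity gives `r (A ∪ S) + r (A ∪ T) ≥ r A + r (S ∪ T)`, and all sets on the right
      -- are independent.
      have h1 := hsub (A ∪ S) (A ∪ T)
      have h2 := hmono (show A ⊆ (A ∪ S) ∩ (A ∪ T) by grind)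
      have h3 := hmono (show S ∪ T ⊆ (A ∪ S) ∪ (A ∪ T) by grind)
      rw [← Finset.coe_union] at hST
      simp only [hST.eRk_eq_encard, hS.eRk_eq_encard, hT.eRk_eq_encard,
        (hI.subset (Finset.coe_subset.2 hA)).eRk_eq_encard, encard_coe_eq_coe_finsetCard,
        ENat.toNat_natCast, Finset.card_union_of_disjoint hdj] at h1 h2 h3 ⊢
      omega)
  exact ⟨Y, hYI, (indep_union_of_toNat_eRk hS hY).1, (indep_union_of_toNat_eRk hS hY).2,
    (indep_union_of_toNat_eRk hT hY').1, (indep_union_of_toNat_eRk hT hY').2⟩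

/-! ### Replacement inside a flat -/

/-- In an independent set `D ∪ E`, the part `D` may be replaced by any independent subset of its
closure. -/
lemma Indep.union_indep_of_subset_closure {A D E : Set α} (hDE : M.Indep (D ∪ E))
    (hdj : Disjoint D E) (hA : M.Indep A) (hAD : A ⊆ M.closure D) : M.Indep (A ∪ E) := by
  rw [hA.union_indep_iff_forall_notMem_closure_right (hDE.subset subset_union_right)]
  intro e he hcl
  refine hDE.notMem_closure_sdiff_of_mem (.inr he.1) ?_
  rw [union_sdiff_distrib, sdiff_singleton_eq_self (hdj.notMem_of_mem_right he.1)]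
  refine M.closure_subset_closure_of_subset_closure (union_subset ?_ ?_) hcl
  · exact hAD.trans (M.closure_subset_closure subset_union_left)
  · exact subset_union_right.trans
      (M.subset_closure _ (union_subset (hDE.subset_ground.trans' subset_union_left)
        (sdiff_subset.trans (hDE.subset_ground.trans' subset_union_right))))

lemma Indep.disjoint_of_subset_closure {A D E : Set α} (hDE : M.Indep (D ∪ E))
    (hdj : Disjoint D E) (hAD : A ⊆ M.closure D) : Disjoint A E := by
  rw [Set.disjoint_left]
  intro e heA heE
  have := (hDE.closure_inter_eq_self_of_subset subset_union_left).subset ⟨hAD heA, .inr heE⟩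
  exact hdj.notMem_of_mem_left this heE

/-- In a base `D ∪ E` with `D` finite, the part `D` may be replaced by any independent subset of its
closure of at least the same size. -/
lemma IsBase.union_isBase_of_subset_closure {A D E : Set α} (hDE : M.IsBase (D ∪ E))
    (hdj : Disjoint D E) (hD : D.Finite) (hA : M.Indep A) (hAD : A ⊆ M.closure D)
    (hcard : D.encard ≤ A.encard) : M.IsBase (A ∪ E) := by
  have hDi := hDE.indep.subset subset_union_left
  refine (hDE.indep.union_indep_of_subset_closure hdj hA hAD).isBase_of_ground_subset_closure ?_
  have hcl : M.closure A = M.closure D := by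
    rw [← M.closure_closure D]
    refine IsRkFinite.closure_eq_closure_of_subset_of_eRk_ge_eRk ?_ hAD ?_
    · rw [← eRk_lt_top_iff]
      exact (M.eRk_mono hAD).trans_lt
        (by rw [eRk_closure_eq, hDi.eRk_eq_encard]; exact hD.encard_lt_top)
    · rwa [eRk_closure_eq, hDi.eRk_eq_encard, hA.eRk_eq_encard]
  rw [← closure_union_closure_left_eq, hcl, closure_union_closure_left_eq, hDE.closure_eq]

/-! ### Finite spanning sets and symmetric exchange -/

variable [M.Finitary]

lemma Indep.exists_finite_subset_mem_closure {I : Set α} (hI : M.Indep I) {e : α}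
    (he : e ∈ M.closure I) : ∃ F ⊆ I, F.Finite ∧ e ∈ M.closure F := by
  by_cases heI : e ∈ I
  · exact ⟨{e}, by simpa, by simp, M.mem_closure_of_mem rfl
      (singleton_subset_iff.2 (hI.subset_ground heI))⟩
  have hdep := (hI.mem_closure_iff_of_notMem heI).1 he
  have hnot := hdep.not_indep
  rw [indep_iff_forall_finite_subset_indep] at hnot
  push Not at hnot
  obtain ⟨J, hJ, hJfin, hJi⟩ := hnot
  have hJI : J \ {e} ⊆ I := by rwa [sdiff_singleton_subset_iff]
  -- A finite dependent `J ⊆ insert e I` remains dependent inside `insert e (J \ {e})`, so the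
  -- independent set `J \ {e}` spans `e`.
  refine ⟨J \ {e}, hJI, hJfin.sdiff, ?_⟩
  rw [(hI.subset hJI).mem_closure_iff, or_iff_left (by simp)]
  refine ⟨fun h ↦ hJi (h.subset (by simp)), ?_⟩
  exact (insert_subset_insert hJI).trans hdep.subset_ground

lemma Indep.exists_finite_subset_subset_closure {I X : Set α} (hI : M.Indep I) (hX : X.Finite)
    (hXI : X ⊆ M.closure I) : ∃ F ⊆ I, F.Finite ∧ X ⊆ M.closure F := by
  choose! F hFI hF hXF using fun e (he : e ∈ X) ↦ hI.exists_finite_subset_mem_closure (hXI he)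
  exact ⟨⋃ e ∈ X, F e, iUnion₂_subset hFI, hX.biUnion hF,
    fun e he ↦ M.closure_subset_closure (subset_biUnion_of_mem he) (hXF e he)⟩

/-- Symmetric exchange of a finite subset `X` of a base. -/
lemma IsBase.exists_symm_exchange_of_finite {X R B : Set α} (hXR : M.IsBase (X ∪ R))
    (hdj : Disjoint X R) (hX : X.Finite) (hB : M.IsBase B) :
    ∃ Y ⊆ B, M.IsBase (R ∪ Y) ∧ Disjoint R Y ∧ M.IsBase (X ∪ B \ Y) ∧ Disjoint X (B \ Y) := by
  classical
  -- Only finite parts matter: `F ⊆ B` spans `X`, and `Q ∪ X` with `Q ⊆ R` finite spans `F`.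
  -- Splitting `F` between `Q` and `X` yields `Y`.
  obtain ⟨F, hFB, hF, hXF⟩ := hB.indep.exists_finite_subset_subset_closure hX
    (by rw [hB.closure_eq]; exact subset_union_left.trans hXR.subset_ground)
  obtain ⟨D, hD, hDfin, hFD⟩ := hXR.indep.exists_finite_subset_subset_closure hF
    (by rw [hXR.closure_eq]; exact hFB.trans hB.subset_ground)
  obtain ⟨Q, hQ⟩ := (hDfin.inter_of_left R).exists_finset_coe
  have hQR : (Q : Set α) ⊆ R := hQ ▸ inter_subset_right
  lift X to Finset α using hX
  lift F to Finset α using hF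
  have hQX : Disjoint Q X := by
    rw [← Finset.disjoint_coe]; exact (hdj.mono_right hQR).symm
  have hFQ : (F : Set α) ⊆ M.closure (Q ∪ X) :=
    hFD.trans (M.closure_subset_closure (by rw [hQ]; grind))
  have hXE := hXR.subset_ground
  obtain ⟨Y, hYF, hQY, hQYdj, hXFY, hXFYdj⟩ := exists_subset_indep_union_indep_union_sdiff
    (hXR.indep.subset (union_subset (hQR.trans subset_union_right) subset_union_left)) hQX
    (hB.indep.subset hFB)
  have hYF' : (Y : Set α) ⊆ F := by simpa using hYF
  have hQYcl : (Q ∪ Y : Set α) ⊆ M.closure (Q ∪ X) :=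
    union_subset ((M.subset_closure _ (by grind)).trans' subset_union_left) (hYF'.trans hFQ)
  have hXFYcl : (X ∪ (F \ Y : Finset α) : Set α) ⊆ M.closure F :=
    union_subset hXF ((M.subset_closure _ (hFB.trans hB.subset_ground)).trans' (by simp))
  have hcard1 := hQY.encard_le_eRk_of_subset hQYcl
  have hcard2 := hXFY.encard_le_eRk_of_subset hXFYcl
  rw [eRk_closure_eq] at hcard1 hcard2
  replace hcard1 := hcard1.trans (M.eRk_le_encard _)
  replace hcard2 := hcard2.trans (M.eRk_le_encard _)
  rw [← Finset.coe_union, ← Finset.coe_union, encard_coe_eq_coe_finsetCard,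
    encard_coe_eq_coe_finsetCard, Nat.cast_le, Finset.card_union_of_disjoint hQYdj,
    Finset.card_union_of_disjoint hQX] at hcard1
  rw [← Finset.coe_union, encard_coe_eq_coe_finsetCard,
    encard_coe_eq_coe_finsetCard, Nat.cast_le, Finset.card_union_of_disjoint hXFYdj] at hcard2
  -- The rank bounds give `|Y| ≤ |X|` and `|X| + |F \ Y| ≤ |F|`, hence `|Y| = |X|`; both
  -- replacements below thus have full size.
  have hcardF := Finset.card_sdiff_add_card_eq_card hYF
  replace hXR : M.IsBase ((Q : Set α) ∪ X ∪ R \ Q) := by convert hXR using 1; grind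
  replace hB : M.IsBase ((F : Set α) ∪ B \ F) := by convert hB using 1; grind
  have d1 : Disjoint (Q ∪ X : Set α) (R \ Q) := by
    rw [disjoint_union_left]
    exact ⟨disjoint_sdiff_right, hdj.mono_right sdiff_subset⟩
  have d2 : Disjoint (F : Set α) (B \ F) := disjoint_sdiff_right
  have b1 := hXR.union_isBase_of_subset_closure d1 (by simp [← Finset.coe_union]) hQY
    hQYcl (by
      rw [← Finset.coe_union, ← Finset.coe_union, encard_coe_eq_coe_finsetCard,
        encard_coe_eq_coe_finsetCard, Nat.cast_le, Finset.card_union_of_disjoint hQYdj,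
        Finset.card_union_of_disjoint hQX]
      omega)
  have b2 := hB.union_isBase_of_subset_closure d2 (by simp) hXFY hXFYcl (by
      rw [← Finset.coe_union, encard_coe_eq_coe_finsetCard,
        encard_coe_eq_coe_finsetCard, Nat.cast_le, Finset.card_union_of_disjoint hXFYdj]
      omega)
  have dj1 := hXR.indep.disjoint_of_subset_closure d1 hQYcl
  have dj2 := hB.indep.disjoint_of_subset_closure d2 hXFYcl
  rw [← Finset.disjoint_coe] at hQYdj hXFYdj
  rw [Finset.coe_sdiff] at *
  refine ⟨Y, hYF'.trans hFB, ?_, ?_, ?_, ?_⟩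
  · convert b1 using 1; grind
  · rw [Set.disjoint_left] at *; grind
  · convert b2 using 1; grind
  · rw [Set.disjoint_left] at *; grind

end Matroid

/-! ### Serial exchange along a well order -/

namespace Matroid

variable {α ι : Type*} {M : Matroid α} [LinearOrder ι]

/-- A finite subset meets the union of the `X k` in finitely many elements. At the largest index
chosen for them, all of these are present and no more of `B` has been removed. -/
lemma indep_biUnion_union_sdiff [M.Finitary] {B : Set α} {X Y : ι → Set α} (hB : M.Indep B)
    {J : Set ι} (hJ : ∀ j ∈ J, Iic j ⊆ J)
    (h : ∀ j ∈ J, M.Indep ((⋃ k ∈ Iic j, X k) ∪ B \ ⋃ k ∈ Iic j, Y k)) :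
    M.Indep ((⋃ k ∈ J, X k) ∪ B \ ⋃ k ∈ J, Y k) := by
  refine indep_of_forall_finite_subset_indep _ fun T hT hTfin ↦ ?_
  obtain hempty | hne := (T ∩ ⋃ k ∈ J, X k).eq_empty_or_nonempty
  · refine hB.subset fun e he ↦ ?_
    obtain h1 | h1 := hT he
    · exact (hempty.subset ⟨he, h1⟩).elim
    · exact h1.1
  obtain ⟨a₀, ha₀⟩ := hne
  have : Nonempty ι := (mem_iUnion.1 ha₀.2).nonempty
  choose! f hfJ hf using fun e (he : e ∈ T ∩ ⋃ k ∈ J, X k) ↦ by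
    simpa only [mem_iUnion₂, exists_prop] using he.2
  obtain ⟨a, ha, hmax⟩ := exists_max_image _ f (hTfin.inter_of_left _) ⟨a₀, ha₀⟩
  refine (h (f a) (hfJ a ha)).subset fun e he ↦ ?_
  obtain h1 | h1 := hT he
  · exact .inl (mem_iUnion₂.2 ⟨f e, hmax e ⟨he, h1⟩, hf e ⟨he, h1⟩⟩)
  · exact .inr ⟨h1.1, fun h2 ↦ h1.2 (biUnion_subset_biUnion_left (hJ _ (hfJ a ha)) h2)⟩

variable [WellFoundedLT ι]

/-- Serial symmetric exchange along a well order. At each index `i` that is not a successor, the part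
of the base `⋃ k, X k` below `i` must span the same flat as some subset of the other base. -/
lemma exists_serial_exchange [M.Finitary] {B₀ B₁ : Set α} (hB₀ : M.IsBase B₀) (hB₁ : M.IsBase B₁)
    {X : ι → Set α} (hXdisj : Pairwise fun i j ↦ Disjoint (X i) (X j)) (hXunion : ⋃ i, X i = B₀)
    (hXfin : ∀ i, (X i).Finite)
    (hlim : ∀ i, (∃ p, Iio i = Iic p) ∨
      ∃ C ⊆ B₁, C ⊆ M.closure (⋃ k ∈ Iio i, X k) ∧ (⋃ k ∈ Iio i, X k) ⊆ M.closure C) :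
    ∃ Y : ι → Set α, (Pairwise fun i j ↦ Disjoint (Y i) (Y j)) ∧ ⋃ i, Y i = B₁ ∧
      (∀ i, M.IsBase (B₀ \ X i ∪ Y i)) ∧
      ∀ i, M.IsBase ((⋃ k ∈ Iio i, X k) ∪ B₁ \ ⋃ k ∈ Iio i, Y k) := by
  have hXB (i) : X i ⊆ B₀ := hXunion ▸ subset_iUnion X i
  -- The invariant is a premise inside the existential, so that `choose` gives a total `g` and the
  -- recursion can be defined before the invariant is proved.
  have hstep (i : ι) (U : Set α) : ∃ W, M.IsBase ((⋃ k ∈ Iio i, X k) ∪ B₁ \ U) →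
      Disjoint (⋃ k ∈ Iio i, X k) (B₁ \ U) → W ⊆ B₁ \ U ∧ M.IsBase (B₀ \ X i ∪ W) ∧
        M.IsBase ((⋃ k ∈ Iic i, X k) ∪ B₁ \ (U ∪ W)) ∧
        Disjoint (⋃ k ∈ Iic i, X k) (B₁ \ (U ∪ W)) := by
    by_cases h : M.IsBase ((⋃ k ∈ Iio i, X k) ∪ B₁ \ U) ∧ Disjoint (⋃ k ∈ Iio i, X k) (B₁ \ U)
    swap
    · exact ⟨∅, fun h1 h2 ↦ (h ⟨h1, h2⟩).elim⟩
    have hlt : (⋃ k ∈ Iio i, X k) ⊆ B₀ \ X i := iUnion₂_subset fun k hk ↦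
      subset_sdiff.2 ⟨hXB k, hXdisj (ne_of_lt hk)⟩
    have hle : (⋃ k ∈ Iic i, X k) = (⋃ k ∈ Iio i, X k) ∪ X i := by
      rw [← Iio_insert, biUnion_insert, union_comm]
    obtain ⟨W, hW, hb, hd, hb', hd'⟩ := IsBase.exists_symm_exchange_of_finite
      (X := X i) (R := B₀ \ X i) (by rwa [union_sdiff_cancel (hXB i)]) disjoint_sdiff_right
      (hXfin i) h.1
    have hWd : Disjoint (⋃ k ∈ Iio i, X k) W := hd.mono_left hlt
    obtain ⟨h1, h2⟩ := h
    have hWB : W ⊆ B₁ \ U := fun e he ↦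
      (hW he).resolve_left fun h ↦ hWd.notMem_of_mem_left h he
    refine ⟨W, fun _ _ ↦ ⟨hWB, hb, ?_, ?_⟩⟩
    · convert hb' using 1
      rw [hle]
      rw [Set.disjoint_left] at hWd
      generalize (⋃ k ∈ Iio i, X k) = P at *
      grind
    · rw [hle]
      rw [Set.disjoint_left] at *
      generalize (⋃ k ∈ Iio i, X k) = P at *
      grind
  choose g hg using hstep
  let Y : ι → Set α := wellFounded_lt.fix fun i Y ↦ g i (⋃ j, ⋃ h : j < i, Y j h)
  have hY (i) : Y i = g i (⋃ k ∈ Iio i, Y k) := wellFounded_lt.fix_eq _ i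
  have hYle (i) : (⋃ k ∈ Iic i, Y k) = (⋃ k ∈ Iio i, Y k) ∪ Y i := by
    rw [← Iio_insert, biUnion_insert, union_comm]
  let P (J : Set ι) : Prop := M.IsBase ((⋃ k ∈ J, X k) ∪ B₁ \ ⋃ k ∈ J, Y k) ∧
    Disjoint (⋃ k ∈ J, X k) (B₁ \ ⋃ k ∈ J, Y k)
  have hsucc (i) (hi : P (Iio i)) :
      Y i ⊆ B₁ \ (⋃ k ∈ Iio i, Y k) ∧ M.IsBase (B₀ \ X i ∪ Y i) ∧ P (Iic i) := by
    have := hg i _ hi.1 hi.2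
    rwa [← hY, ← hYle] at this
  have hdisj (J : Set ι) (hJ : ∀ j ∈ J, Iic j ⊆ J) (hP : ∀ j ∈ J, P (Iic j)) :
      Disjoint (⋃ k ∈ J, X k) (B₁ \ ⋃ k ∈ J, Y k) := by
    rw [disjoint_iUnion₂_left]
    exact fun k hk ↦ (hP k hk).2.mono (subset_biUnion_of_mem (u := X) self_mem_Iic)
      (sdiff_subset_sdiff_right (biUnion_subset_biUnion_left (hJ k hk)))
  have hlow (i : ι) : ∀ j ∈ Iio i, Iic j ⊆ Iio i := fun j hj k hk ↦ lt_of_le_of_lt hk hj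
  have hP (i) : P (Iio i) := by
    induction i using WellFoundedLT.induction with
    | ind i ih =>
      obtain ⟨p, hp⟩ | ⟨C, hCB, hCX, hXC⟩ := hlim i
      · have hpi : p ∈ Iio i := hp ▸ self_mem_Iic
        rw [hp]
        exact (hsucc p (ih p hpi)).2.2
      have hPle : ∀ j ∈ Iio i, P (Iic j) := fun j hj ↦ (hsucc j (ih j hj)).2.2
      refine ⟨?_, hdisj _ (hlow i) hPle⟩
      refine (indep_biUnion_union_sdiff hB₁.indep (hlow i)
        fun j hj ↦ (hPle j hj).1.indep).isBase_of_ground_subset_closure ?_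
      -- If some `e ∈ Y j` were outside `C`, the base reached after stage `j` would lie in the
      -- closure of `B₁ \ {e}`, which does not contain `e`.
      have hYC : (⋃ k ∈ Iio i, Y k) ⊆ C := by
        refine iUnion₂_subset fun j hj e he ↦ ?_
        by_contra heC
        have heB : e ∈ B₁ := ((hsucc j (ih j hj)).1 he).1
        refine hB₁.indep.notMem_closure_sdiff_of_mem heB ?_
        have hsub : (⋃ k ∈ Iic j, X k) ∪ (B₁ \ ⋃ k ∈ Iic j, Y k) ⊆ M.closure (B₁ \ {e}) := by
          refine union_subset ?_ ?_
          · exact (biUnion_subset_biUnion_left (hlow i j hj)).trans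
              (hXC.trans (M.closure_subset_closure (subset_sdiff_singleton hCB heC)))
          · refine (M.subset_closure _ (sdiff_subset.trans hB₁.subset_ground)).trans' ?_
            refine sdiff_subset_sdiff_right ?_
            rw [singleton_subset_iff]
            exact mem_biUnion (t := Y) self_mem_Iic he
        have := M.closure_subset_closure_of_subset_closure hsub
        rw [(hPle j hj).1.closure_eq] at this
        exact this (hB₁.subset_ground heB)
      rw [← hB₁.closure_eq]
      refine M.closure_subset_closure_of_subset_closure fun e he ↦ ?_
      by_cases heC : e ∈ C
      · exact M.closure_subset_closure subset_union_left (hCX heC)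
      · refine M.mem_closure_of_mem (.inr ⟨he, fun h ↦ heC (hYC h)⟩) (union_subset ?_ ?_)
        · exact (iUnion₂_subset fun k _ ↦ hXB k).trans hB₀.subset_ground
        · exact sdiff_subset.trans hB₁.subset_ground
  have hYB (i) : Y i ⊆ B₁ := (hsucc i (hP i)).1.trans sdiff_subset
  have hYlt {i j} (hij : i < j) : Disjoint (Y i) (Y j) :=
    (disjoint_sdiff_right.mono_right (hsucc j (hP j)).1).mono_left
      (subset_biUnion_of_mem (u := Y) (mem_Iio.2 hij))
  refine ⟨Y, fun i j hij ↦ ?_, (iUnion_subset hYB).antisymm ?_, fun i ↦ (hsucc i (hP i)).2.1,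
    fun i ↦ (hP i).1⟩
  · obtain h | h := hij.lt_or_gt
    · exact hYlt h
    · exact (hYlt h).symm
  have hPle : ∀ j ∈ Set.univ, P (Iic j) := fun j _ ↦ (hsucc j (hP j)).2.2
  have hi := indep_biUnion_union_sdiff hB₁.indep (J := Set.univ) (by simp)
    fun j hj ↦ (hPle j hj).1.indep
  have hd := hdisj Set.univ (by simp) hPle
  simp only [mem_univ, iUnion_true, hXunion] at hi hd
  -- The leftover of `B₁` lies in `B₀` by maximality, yet is disjoint from it, so it is empty.
  have heq := hB₀.eq_of_subset_indep hi subset_union_left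
  rw [← sdiff_eq_empty, ← Set.bot_eq_empty, ← disjoint_self]
  refine hd.mono_left ?_
  rw [heq]
  exact subset_union_right

end Matroid

/-! ### Reordering an uncountable initial ordinal -/

lemma countable_setOf_reflTransGen {ι : Type*} {G : ι → Set ι} (hG : ∀ i, (G i).Countable) (a : ι) :
    {i | Relation.ReflTransGen (fun x y ↦ y ∈ G x) a i}.Countable := by
  let A : ℕ → Set ι := Nat.rec {a} fun _ S ↦ ⋃ i ∈ S, G i
  have hA (n) : (A n).Countable := by
    induction n with
    | zero => exact countable_singleton a
    | succ n ih => exact ih.biUnion fun i _ ↦ hG i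
  refine (countable_iUnion hA).mono fun i hi ↦ ?_
  induction hi with
  | refl => exact mem_iUnion.2 ⟨0, rfl⟩
  | tail _ hbc ih =>
    obtain ⟨n, hn⟩ := mem_iUnion.1 ih
    exact mem_iUnion.2 ⟨n + 1, mem_biUnion hn hbc⟩

/-- In a longer order, the element at position `(#ι).ord` would have `#ι` predecessors. -/
lemma Ordinal.type_eq_ord_of_forall_mk_lt {ι : Type u} (r : ι → ι → Prop) [IsWellOrder ι r]
    (h : ∀ i, #{j // r j i} < #ι) : Ordinal.type r = (#ι).ord := by
  refine le_antisymm (le_of_not_gt fun hlt ↦ ?_) (ord_le_type r)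
  obtain ⟨x, hx⟩ := Ordinal.typein_surj r hlt
  have := congrArg Ordinal.card hx
  rw [Ordinal.card_typein, card_ord] at this
  exact (h x).ne this

/-- An uncountable initial ordinal can be reordered so that all initial segments of limit length are
closed under a given countable-valued set function. -/
lemma exists_perm_forall_isSucc_or_closed {ι : Type u} [LinearOrder ι] [WellFoundedLT ι]
    (hι : ∀ i : ι, #(Iio i) < #ι) (hunc : ℵ₀ < #ι) {G : ι → Set ι} (hG : ∀ i, (G i).Countable) :
    ∃ σ : Equiv.Perm ι, ∀ i, (∃ p, Iio i = Iic p) ∨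
      ∀ j < i, ∀ k ∈ G (σ j), ∃ l < i, σ l = k := by
  -- Indices are grouped by `ρ i`, the least index from which `i` is reachable, and ordered
  -- lexicographically by `ρ` and an enumeration of the countable set reachable from it. Steps along
  -- `G` never raise `ρ`. Proper initial segments stay smaller than `#ι`, so the order type is
  -- unchanged.
  let reach (a i : ι) : Prop := Relation.ReflTransGen (fun x y ↦ y ∈ G x) a i
  have hne (i) : {a | reach a i}.Nonempty := ⟨i, .refl⟩
  let ρ (i : ι) : ι := wellFounded_lt.min {a | reach a i} (hne i)
  have hρ (i) : reach (ρ i) i := wellFounded_lt.min_mem _ (hne i)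
  have hρle {i k} (hk : k ∈ G i) : ρ k ≤ ρ i :=
    wellFounded_lt.min_le (s := {a | reach a k}) ((hρ i).tail hk)
  choose f hf using fun a ↦ countable_iff_exists_injOn.1 (countable_setOf_reflTransGen hG a)
  let φ (i : ι) : ι ×ₗ ℕ := toLex (ρ i, f (ρ i) i)
  have hφ : Function.Injective φ := fun i j hij ↦ by
    have h := Prod.ext_iff.1 (toLex.injective hij)
    have h1 : ρ i = ρ j := h.1
    have h2 : f (ρ i) i = f (ρ j) j := h.2
    rw [← h1] at h2
    exact hf (ρ i) (hρ i) (h1 ▸ hρ j) h2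
  have hlex {i j} : φ i < φ j ↔ ρ i < ρ j ∨ ρ i = ρ j ∧ f (ρ i) i < f (ρ j) j :=
    Prod.Lex.toLex_lt_toLex
  have hwo : IsWellOrder ι (φ ⁻¹'o (· < ·)) :=
    (RelEmbedding.preimage ⟨φ, hφ⟩ (· < ·)).isWellOrder
  have hseg (i) : #{j // (φ ⁻¹'o (· < ·)) j i} < #ι := by
    have hIic : #(Iic (ρ i)) < #ι := by
      rw [← Iio_insert]
      exact mk_insert_le.trans_lt (add_lt_of_lt hunc.le (hι _) (one_lt_aleph0.trans hunc))
    refine lt_of_le_of_lt ?_ (mul_lt_of_lt hunc.le hIic hunc)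
    have hle {j} (h : φ j < φ i) : ρ j ≤ ρ i := by
      rw [hlex] at h
      exact h.elim le_of_lt fun h ↦ h.1.le
    have := mk_le_of_injective (f := fun j : {j // (φ ⁻¹'o (· < ·)) j i} ↦
      ((⟨ρ j, hle j.2⟩, f (ρ j) j) : Iic (ρ i) × ℕ)) fun a b hab ↦ by
        simp only [Prod.mk.injEq] at hab
        exact Subtype.ext (hφ (congrArg toLex (Prod.ext (congrArg Subtype.val hab.1) hab.2)))
    simpa using this
  obtain ⟨e⟩ := Ordinal.type_eq.1 ((Ordinal.type_eq_ord_of_forall_mk_lt (· < ·) hι).trans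
    (Ordinal.type_eq_ord_of_forall_mk_lt (φ ⁻¹'o (· < ·)) hseg).symm)
  have he {i j} : φ (e i) < φ (e j) ↔ i < j := e.map_rel_iff
  refine ⟨e.toEquiv, fun i ↦ ?_⟩
  -- If `e i` comes first in its group, its predecessors form whole groups and are closed under `G`.
  -- Otherwise it has finitely many predecessors in the group, and the last one is its immediate
  -- predecessor.
  let T : Set ι := {j | j < i ∧ ρ (e j) = ρ (e i)}
  obtain hT | hT := T.eq_empty_or_nonempty
  · right
    intro j hj k hk
    have hlt : ρ (e j) < ρ (e i) := (hlex.1 (he.2 hj)).resolve_right fun h ↦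
      hT.subset (show j ∈ T from ⟨hj, h.1⟩)
    refine ⟨e.symm k, he.1 ?_, e.apply_symm_apply k⟩
    rw [e.apply_symm_apply, hlex]
    exact .inl ((hρle hk).trans_lt hlt)
  · left
    have hTfin : T.Finite := by
      refine Finite.of_injOn (f := fun j ↦ f (ρ (e i)) (e j)) (t := Iio (f (ρ (e i)) (e i)))
        (fun j hj ↦ ?_) (fun j hj k hk hjk ↦ ?_) (finite_Iio _)
      · have := (hlex.1 (he.2 hj.1)).resolve_left hj.2.not_lt
        rw [hj.2] at this
        exact this.2
      · exact e.injective (hf _ (hj.2 ▸ hρ (e j)) (hk.2 ▸ hρ (e k)) hjk)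
    obtain ⟨p, hp, hmax⟩ := exists_max_image T id hTfin hT
    refine ⟨p, Set.ext fun l ↦ ⟨fun hl ↦ le_of_not_gt fun hpl ↦ ?_, fun hl ↦ lt_of_le_of_lt hl hp.1⟩⟩
    have hle {a b} (h : a < b) : ρ (e a) ≤ ρ (e b) :=
      (hlex.1 (he.2 h)).elim le_of_lt fun h ↦ h.1.le
    exact (hmax l ⟨hl, (hle hl).antisymm (hp.2 ▸ hle hpl)⟩).not_gt hpl

/-! ### Dependence between blocks -/

namespace Matroid

/-- Given a partition `X` of a base into finite sets and another base `B₁`, each index depends on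
countably many others, such that over an index set closed under this dependence, the union of the
`X i` spans the same flat as some subset of `B₁`. -/
lemma IsBase.exists_countable_dependence {α ι : Type*} {M : Matroid α} [M.Finitary] {B₀ B₁ : Set α}
    (hB₀ : M.IsBase B₀) (hB₁ : M.IsBase B₁) {X : ι → Set α}
    (hXdisj : Pairwise fun i j ↦ Disjoint (X i) (X j)) (hXunion : ⋃ i, X i = B₀)
    (hXfin : ∀ i, (X i).Finite) :
    ∃ G : ι → Set ι, (∀ i, (G i).Countable) ∧ ∀ J : Set ι, (∀ i ∈ J, G i ⊆ J) →
      ∃ C ⊆ B₁, C ⊆ M.closure (⋃ k ∈ J, X k) ∧ (⋃ k ∈ J, X k) ⊆ M.closure C := by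
  have hXB (i) : X i ⊆ B₀ := hXunion ▸ subset_iUnion X i
  choose F hFB hF hXF using fun i ↦ hB₁.indep.exists_finite_subset_subset_closure (hXfin i)
    (by rw [hB₁.closure_eq]; exact (hXB i).trans hB₀.subset_ground)
  choose D hDB hD hFD using fun i ↦ hB₀.indep.exists_finite_subset_subset_closure (hF i)
    (by rw [hB₀.closure_eq]; exact (hFB i).trans hB₁.subset_ground)
  -- `G i` collects the blocks meeting `D i`, so over a closed `J` the blocks span every `F i`, and
  -- the union of these `F i` serves as `C`.
  refine ⟨fun i ↦ ⋃ d ∈ D i, {k | d ∈ X k}, fun i ↦ (hD i).countable.biUnion fun d _ ↦ ?_,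
    fun J hJ ↦ ⟨⋃ i ∈ J, F i, iUnion₂_subset fun i _ ↦ hFB i, ?_, ?_⟩⟩
  · refine Subsingleton.countable fun k hk l hl ↦ ?_
    by_contra hkl
    exact (hXdisj hkl).notMem_of_mem_left hk hl
  · refine iUnion₂_subset fun i hi ↦ (hFD i).trans (M.closure_subset_closure fun d hd ↦ ?_)
    obtain ⟨k, hk⟩ := mem_iUnion.1 (hXunion ▸ hDB i hd)
    exact mem_biUnion (hJ i hi (mem_biUnion hd hk)) hk
  · exact iUnion₂_subset fun i hi ↦
      (hXF i).trans (M.closure_subset_closure (subset_biUnion_of_mem hi))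

end Matroid

/-! ### Ordinal indices and assembly -/

lemma Cardinal.mk_Iio_lt_mk_Iio_ord {κ : Cardinal.{v}} (i : Iio κ.ord) :
    #(Iio i) < #(Iio κ.ord) := by
  have hle : #(Iio i) ≤ #(Iio i.1) :=
    mk_le_of_injective (f := fun j : Iio i ↦ (⟨j.1.1, j.2⟩ : Iio i.1)) fun a b hab ↦
      Subtype.ext (Subtype.ext (Subtype.mk.inj hab))
  refine hle.trans_lt ?_
  rw [mk_Iio_ordinal, mk_Iio_ordinal, lift_lt, card_ord]
  exact lt_ord.1 i.2

lemma Ordinal.Iio_eq_empty_or_exists_Iic_of_le_omega0 {o : Ordinal.{v}} (ho : o ≤ Ordinal.omega0)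
    (i : Iio o) : Iio i = ∅ ∨ ∃ p, Iio i = Iic p := by
  obtain ⟨i, hi⟩ := i
  obtain ⟨n, rfl⟩ := Ordinal.lt_omega0.1 (lt_of_lt_of_le hi ho)
  cases n with
  | zero =>
    left
    ext j
    simp [← Subtype.coe_lt_coe]
  | succ n =>
    right
    refine ⟨⟨n, mem_Iio.2 (lt_trans (Nat.cast_lt.2 n.lt_succ_self) (mem_Iio.1 hi))⟩, ?_⟩
    ext j
    rw [mem_Iio, mem_Iic, ← Subtype.coe_lt_coe, ← Subtype.coe_le_coe]
    simp only [Nat.cast_succ, Order.lt_add_one_iff]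

lemma iUnion_sdiff_biUnion {α ι : Type*} {Z : ι → Set α}
    (hZ : Pairwise fun i j ↦ Disjoint (Z i) (Z j)) (J : Set ι) :
    (⋃ j, Z j) \ (⋃ k ∈ J, Z k) = ⋃ j ∈ Jᶜ, Z j := by
  ext x
  simp only [mem_sdiff, mem_iUnion, exists_prop, not_exists, not_and, mem_compl_iff]
  refine ⟨fun ⟨⟨j, hj⟩, h⟩ ↦ ⟨j, fun hJ ↦ h j hJ hj, hj⟩, fun ⟨j, hJ, hj⟩ ↦ ⟨⟨j, hj⟩, ?_⟩⟩
  intro k hk hxk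
  exact (hZ fun h : j = k ↦ hJ (h ▸ hk)).notMem_of_mem_left hj hxk

theorem mainTheorem1 {α : Type u} (M : Matroid α) [M.Finitary] (B₀ B₁ : Set α)
    (hB₀ : M.IsBase B₀) (hB₁ : M.IsBase B₁)
    (κ : Cardinal.{v}) (X : Set.Iio κ.ord → Set α)
    (hXdisj : Pairwise fun i j => Disjoint (X i) (X j))
    (hXunion : ⋃ i, X i = B₀)
    (hXfin : ∀ i, (X i).Finite) :
    ∃ (Y : Set.Iio κ.ord → Set α) (σ : Equiv.Perm (Set.Iio κ.ord)),
      (Pairwise fun i j => Disjoint (Y i) (Y j)) ∧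
      (⋃ i, Y i = B₁) ∧
      (∀ i, (X i).Nonempty → (Y i).Nonempty) ∧
      (∀ i, M.IsBase ((B₀ \ X i) ∪ Y i)) ∧
      (∀ i, M.IsBase ((B₀ \ ⋃ j ≥ i, X (σ j)) ∪ ⋃ j ≥ i, Y (σ j))) ∧
      (κ ≤ Cardinal.aleph0 → σ = Equiv.refl _) := by
  obtain ⟨σ, hσ, hlim⟩ : ∃ σ : Equiv.Perm (Iio κ.ord), (κ ≤ ℵ₀ → σ = Equiv.refl _) ∧
      ∀ i, (∃ p, Iio i = Iic p) ∨ ∃ C ⊆ B₁, C ⊆ M.closure (⋃ k ∈ Iio i, X (σ k)) ∧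
        (⋃ k ∈ Iio i, X (σ k)) ⊆ M.closure C := by
    obtain hκ | hκ := le_or_gt κ ℵ₀
    · refine ⟨Equiv.refl _, fun _ ↦ rfl, fun i ↦ ?_⟩
      obtain h | h := Ordinal.Iio_eq_empty_or_exists_Iic_of_le_omega0
        (by rw [← ord_aleph0]; exact ord_le_ord.2 hκ) i
      · exact .inr ⟨∅, by simp, by simp, by simp [h]⟩
      · exact .inl h
    · obtain ⟨G, hG, hclosed⟩ := hB₀.exists_countable_dependence hB₁ hXdisj hXunion hXfin
      obtain ⟨σ, hσ⟩ := exists_perm_forall_isSucc_or_closed (mk_Iio_lt_mk_Iio_ord (κ := κ))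
        (by rw [mk_Iio_ordinal, card_ord]; simpa using hκ) hG
      refine ⟨σ, fun h ↦ (hκ.not_ge h).elim, fun i ↦ (hσ i).imp_right fun h ↦ ?_⟩
      have := hclosed (σ '' Iio i) (by
        rintro _ ⟨j, hj, rfl⟩ k hk
        exact h j hj k hk)
      simpa only [biUnion_image] using this
  obtain ⟨Y, hYdisj, hYunion, hY, hYtail⟩ := Matroid.exists_serial_exchange hB₀ hB₁
    (X := fun i ↦ X (σ i)) (fun i j hij ↦ hXdisj (σ.injective.ne hij))
    ((σ.surjective.iUnion_comp X).trans hXunion) (fun i ↦ hXfin _) hlim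
  have hbase (i) : M.IsBase ((B₀ \ X i) ∪ Y (σ.symm i)) := by simpa using hY (σ.symm i)
  refine ⟨fun i ↦ Y (σ.symm i), σ, fun i j hij ↦ hYdisj (σ.symm.injective.ne hij),
    (σ.symm.surjective.iUnion_comp Y).trans hYunion, fun i hi ↦ ?_, hbase, fun i ↦ ?_, hσ⟩
  -- With `Y` empty here, `B₀ \ X i` would be a base properly inside `B₀`.
  · by_contra hempty
    rw [not_nonempty_iff_eq_empty] at hempty
    have h := hbase i
    simp only [hempty, union_empty] at h
    obtain ⟨x, hx⟩ := hi
    have hxB : x ∈ B₀ := hXunion ▸ mem_iUnion_of_mem i hx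
    rw [← h.eq_of_subset_isBase hB₀ sdiff_subset] at hxB
    exact hxB.2 hx
  · simp only [σ.symm_apply_apply]
    -- Complementing within each partition turns the base of stage `i` into the required tail form.
    have hX' := iUnion_sdiff_biUnion (Z := fun i ↦ X (σ i))
      (fun i j hij ↦ hXdisj (σ.injective.ne hij)) (Ici i)
    have hY' := iUnion_sdiff_biUnion hYdisj (Iio i)
    rw [σ.surjective.iUnion_comp X, hXunion, compl_Ici] at hX'
    rw [hYunion, compl_Iio] at hY'
    have h := hYtail i
    rwa [hY', ← hX'] at h
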